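/- Consider the scalar second order delay differential equation with damping $$\ddot x(t)+a(t)\dot x(t)+b(t)x(t)+a_1(t)\dot x(g(t))+b_1(t)x(h(t))=0,\qquad t\ge 0, \tag{2}$$ where $a,b,a_1,b_1$ are Lebesgue measurable and essentially bounded on $[0,\infty)$, and $g,h:[0,\infty)\to\mathbb R$ are Lebesgue measurable with $g(t)\le t$, $h(t)\le t$ for $t\ge0$, $\limsup_{t\to\infty}(t-g(t))<\infty$ and $\limsup_{t\to\infty}(t-h(t))<\infty$. For $s\ge 0$, Borel measurable bounded functions $\varphi,\psi:(-\infty,s)\to\mathbb R$ and $x_0,x_0'\in\mathbb R$, a solution of the initial value problem with these data is a function $x:\mathbb R\to\mathbb R$ with $x=\varphi$ on $(-\infty,s)$, $x(s)=x_0$, which on $[s,\infty)$ is differentiable (one-sidedly at $s$) with a locally absolutely continuous derivative $\dot x$, $\dot x(s)=x_0'$, and which satisfies (2) for almost every $t\ge s$, where $\dot x(g(t))$ is read as $\psi(g(t))$ if $g(t)<s$. Equation (2) is called (uniformly) exponentially stable if there exist $M>0$ and $\mu>0$ such that for all $s\ge 0$ and all such data every solution satisfies $$|x(t)|\le M e^{-\mu(t-s)}\Bigl[|x_0|+|x_0'|+\sup_{r<s}\bigl(|\varphi(r)|+|\psi(r)|\bigr)\Bigr],\qquad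 t\ge s.$$ Suppose that for some $t_0\ge 0$, with (essential) infima and suprema, $$\inf_{t\ge t_0}a(t)>0,\qquad \inf_{t\ge t_0}b(t)>0,\qquad \Bigl(\inf_{t\ge t_0}a(t)\Bigr)^2\ge 4\sup_{t\ge t_0}b(t),$$ and that $a_1(t)=0$ for almost every $t\ge t_0$ and, for some constant $\tau$, $t-h(t)\le\tau$ for all $t\ge t_0$. If $\left\|\frac{b_1}{b}\right\|<1$, where $\|\cdot\|$ is the norm in $L_\infty[t_0,\infty)$, then equation (2) is exponentially stable (whatever the size of $\tau$). -/

import Mathlib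

open MeasureTheory Set Filter

noncomputable section

/-- The data of the linear delay differential equation with damping
`x''(t) + a(t) x'(t) + b(t) x(t) + a₁(t) x'(g(t)) + b₁(t) x(h(t)) = 0`.
Only the values at arguments `t ≥ 0` matter. -/
structure DampedDelayEquation where
  a : ℝ → ℝ
  b : ℝ → ℝ
  a₁ : ℝ → ℝ
  b₁ : ℝ → ℝ
  g : ℝ → ℝ
  h : ℝ → ℝ

namespace DampedDelayEquation

/-- `f` is Lebesgue measurable and essentially bounded on `[t₀, ∞)`. -/
def EssBddFrom (t₀ : ℝ) (f : ℝ → ℝ) : Prop :=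
  MemLp f ⊤ (volume.restrict (Ici t₀))

/-- `d` is an admissible delayed argument: Lebesgue measurable on `[0, ∞)`, `d(t) ≤ t` for `t ≥ 0`
and `limsup_{t → ∞} (t - d(t)) < ∞`. -/
structure IsDelayedArgument (d : ℝ → ℝ) : Prop where
  aemeasurable : AEMeasurable d (volume.restrict (Ici 0))
  le_self : ∀ t, 0 ≤ t → d t ≤ t
  limsup_lt_top : ∃ C : ℝ, ∀ᶠ t in atTop, t - d t ≤ C

/-- The standing assumptions on the equation. -/
structure IsAdmissible (E : DampedDelayEquation) : Prop where
  essBdd_a : EssBddFrom 0 E.a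
  essBdd_b : EssBddFrom 0 E.b
  essBdd_a₁ : EssBddFrom 0 E.a₁
  essBdd_b₁ : EssBddFrom 0 E.b₁
  delayed_g : IsDelayedArgument E.g
  delayed_h : IsDelayedArgument E.h

/-- `φ` is a Borel measurable bounded function on `(-∞, t₀)`. -/
structure IsInitialFunction (t₀ : ℝ) (φ : ℝ → ℝ) : Prop where
  measurable : Measurable (fun t : Iio t₀ => φ t)
  bounded : ∃ C : ℝ, ∀ t, t < t₀ → |φ t| ≤ C

/-- `x`, with `y` in the role of `x'`, solves the initial value problem
`x'' + a x' + b x + a₁ x'(g) + b₁ x(h) = 0` for `t ≥ t₀`,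
`x = φ` and `x' = ψ` for `t < t₀`, `x(t₀) = x₀`, `x'(t₀) = x₀'`.
Before `t₀`, the functions `φ` and `ψ` are independent data (`ψ` need not be the derivative of `φ`);
on `[t₀, ∞)`, `y` is the derivative of `x` and is locally absolutely continuous. -/
structure IsSolution (E : DampedDelayEquation) (t₀ : ℝ) (φ ψ : ℝ → ℝ) (x₀ x₀' : ℝ)
    (x y : ℝ → ℝ) : Prop where
  eq_before : ∀ t, t < t₀ → x t = φ t
  deriv_eq_before : ∀ t, t < t₀ → y t = ψ t
  eq_at : x t₀ = x₀
  deriv_eq_at : y t₀ = x₀'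
  hasDeriv : ∀ t, t₀ ≤ t → HasDerivWithinAt x (y t) (Ici t₀) t
  absCont : ∀ T, t₀ ≤ T → AbsolutelyContinuousOnInterval y t₀ T
  equation : ∀ᵐ t ∂(volume.restrict (Ici t₀)),
    deriv y t + E.a t * y t + E.b t * x t + E.a₁ t * y (E.g t) + E.b₁ t * x (E.h t) = 0

/-- (Uniform) exponential stability: `M` and `μ` depend neither on the initial point `t₀` nor on
the initial data. -/
def ExponentiallyStable (E : DampedDelayEquation) : Prop :=
  ∃ M : ℝ, 0 < M ∧ ∃ μ : ℝ, 0 < μ ∧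
    ∀ (t₀ : ℝ) (φ ψ : ℝ → ℝ) (x₀ x₀' : ℝ) (x y : ℝ → ℝ), 0 ≤ t₀ →
      IsInitialFunction t₀ φ → IsInitialFunction t₀ ψ →
      E.IsSolution t₀ φ ψ x₀ x₀' x y →
      ∀ t, t₀ ≤ t →
        |x t| ≤ M * Real.exp (-μ * (t - t₀)) *
          (|x₀| + |x₀'| + ⨆ s : Iio t₀, (|φ s| + |ψ s|))

/-- With `a₀ = inf a`, `b₀ = inf b`, `B = sup b` over `[t₀, ∞)` (essential bounds, as the
coefficients matter only up to null sets): `a₀ > 0`, `b₀ > 0` and `a₀² ≥ 4B`. -/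
structure DampingCondition (E : DampedDelayEquation) (t₀ : ℝ) : Prop where
  inf_a_pos : 0 < essInf E.a (volume.restrict (Ici t₀))
  inf_b_pos : 0 < essInf E.b (volume.restrict (Ici t₀))
  four_mul_sup_b_le :
    4 * essSup E.b (volume.restrict (Ici t₀)) ≤ essInf E.a (volume.restrict (Ici t₀)) ^ 2

end DampedDelayEquation

end

/-! Let l be half of the essential infimum of a, and z = x' + l x. Once a₁ vanishes, the equation is
the system x' = -l x + z, z' = -(a - l) z + (l(a - l) - b) x - b₁ x(h). The coefficient l(a - l) - b
is nonnegative because a ≥ 2l and b ≤ l², which is what the damping condition says. So the undelayed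
part is cooperative and |x|, |z| can be compared with K e^{-mt} (1, l - m). The first row preserves
this barrier with equality; the second asks for m a - m² ≤ b (1 - q e^{mτ}), where q = ‖b₁/b‖ < 1.
At m = 0 there is slack for every τ, so some small m > 0 works. The comparison is a first-exit
argument (`abs_lt_mul_exp_of_abs_deriv_add_le_of_forall`), applied to (x, z) in
`IsSolution.abs_lt_mul_exp`. Before t₀, only the crude bound of `IsAdmissible.exists_growth_bound`
is available; it costs a constant factor, as that stretch has length at most t₀. -/

/-! ### Exponential barriers and first exit -/

/-- A scalar barrier: a differential inequality for `p` keeps `|p|` below an exponential. -/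
lemma abs_lt_mul_exp_of_abs_deriv_add_le {p : ℝ → ℝ} {s T α k c : ℝ} (hsT : s ≤ T)
    (hp : AbsolutelyContinuousOnInterval p s T) (h0 : |p s| < α)
    (hd : ∀ᵐ t, t ∈ Ioc s T →
      |deriv p t + c * p t| ≤ (k + c) * (α * Real.exp (k * (t - s)))) :
    |p T| < α * Real.exp (k * (T - s)) := by
  have hexp : ∀ κ t : ℝ, HasDerivAt (fun t => Real.exp (κ * (t - s)))
      (κ * Real.exp (κ * (t - s))) t := fun κ t => by
    have := (((hasDerivAt_id t).sub_const s).const_mul κ).exp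
    simpa [mul_comm] using this
  have hEac : AbsolutelyContinuousOnInterval (fun t => Real.exp (c * (t - s))) s T := by
    apply ContDiffOn.absolutelyContinuousOnInterval
    fun_prop
  have hq := hEac.fun_mul hp
  have hFTC := hq.integral_deriv_eq_sub
  have hG : ∫ t in s..T, (k + c) * (α * Real.exp ((k + c) * (t - s))) =
      α * Real.exp ((k + c) * (T - s)) - α := by
    have := intervalIntegral.integral_eq_sub_of_hasDerivAt (a := s) (b := T)
      (f := fun t => α * Real.exp ((k + c) * (t - s)))
      (f' := fun t => (k + c) * (α * Real.exp ((k + c) * (t - s))))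
      (fun t _ => ((hexp (k + c) t).const_mul α).congr_deriv (by ring))
      (Continuous.intervalIntegrable (by fun_prop) _ _)
    simpa using this
  -- The integrating factor e^{c(t-s)} turns p' + c p into an exact derivative, and the bound into
  -- the derivative of α e^{(k+c)(t-s)}. Strictness at s therefore survives a non-strict inequality.
  have hbound : ‖∫ t in s..T, deriv (fun t => Real.exp (c * (t - s)) * p t) t‖ ≤
      ∫ t in s..T, (k + c) * (α * Real.exp ((k + c) * (t - s))) := by
    refine intervalIntegral.norm_integral_le_of_norm_le hsT ?_
      (Continuous.intervalIntegrable (by fun_prop) _ _)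
    filter_upwards [hd, hp.ae_differentiableAt] with t h1 h2 ht
    have hdt := h2 (by rw [uIcc_of_le hsT]; exact Ioc_subset_Icc_self ht)
    have hder : HasDerivAt (fun t => Real.exp (c * (t - s)) * p t)
        (c * Real.exp (c * (t - s)) * p t + Real.exp (c * (t - s)) * deriv p t) t :=
      (hexp c t).mul hdt.hasDerivAt
    rw [hder.deriv, Real.norm_eq_abs]
    have : c * Real.exp (c * (t - s)) * p t + Real.exp (c * (t - s)) * deriv p t =
        Real.exp (c * (t - s)) * (deriv p t + c * p t) := by ring
    rw [this, abs_mul, abs_of_pos (Real.exp_pos _)]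
    calc _ ≤ Real.exp (c * (t - s)) * ((k + c) * (α * Real.exp (k * (t - s)))) := by
          gcongr; exact h1 ht
      _ = _ := by rw [add_mul k c (t - s), Real.exp_add]; ring
  rw [hFTC, hG, Real.norm_eq_abs] at hbound
  simp only [sub_self, mul_zero, Real.exp_zero, one_mul] at hbound
  have h1 : |Real.exp (c * (T - s)) * p T| < α * Real.exp ((k + c) * (T - s)) := by
    have := abs_sub_abs_le_abs_sub (Real.exp (c * (T - s)) * p T) (p s)
    linarith
  rw [abs_mul, abs_of_pos (Real.exp_pos _), add_mul, Real.exp_add] at h1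
  refine lt_of_mul_lt_mul_left (a := Real.exp (c * (T - s))) ?_ (Real.exp_pos _).le
  linarith

/-- A first-exit argument for a pair of functions: if the differential inequalities hold almost
everywhere as long as the exponential bounds do, then the bounds persist. -/
lemma abs_lt_mul_exp_of_abs_deriv_add_le_of_forall {p w : ℝ → ℝ} {s T α β k c : ℝ}
    (hp : AbsolutelyContinuousOnInterval p s T) (hw : AbsolutelyContinuousOnInterval w s T)
    (hp0 : |p s| < α) (hw0 : |w s| < β)
    (hd : ∀ᵐ t, t ∈ Ioo s T →
      (∀ r ∈ Icc s t, |p r| < α * Real.exp (k * (r - s)) ∧ |w r| < β * Real.exp (k * (r - s))) →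
      |deriv p t + c * p t| ≤ (k + c) * (α * Real.exp (k * (t - s))) ∧
      |deriv w t + c * w t| ≤ (k + c) * (β * Real.exp (k * (t - s)))) :
    ∀ t ∈ Icc s T,
      |p t| < α * Real.exp (k * (t - s)) ∧ |w t| < β * Real.exp (k * (t - s)) := by
  intro t₁ ht₁
  have hsT : s ≤ T := ht₁.1.trans ht₁.2
  have hpc := hp.continuousOn
  have hwc := hw.continuousOn
  rw [uIcc_of_le hsT] at hpc hwc
  by_contra hcon
  set S : Set ℝ := {t ∈ Icc s T | α * Real.exp (k * (t - s)) ≤ |p t|} ∪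
    {t ∈ Icc s T | β * Real.exp (k * (t - s)) ≤ |w t|} with hS
  have hSc : IsCompact S := by
    refine IsCompact.union ?_ ?_
    · exact isCompact_Icc.of_isClosed_subset
        (isClosed_Icc.isClosed_le (by fun_prop) hpc.abs) (fun t ht => ht.1)
    · exact isCompact_Icc.of_isClosed_subset
        (isClosed_Icc.isClosed_le (by fun_prop) hwc.abs) (fun t ht => ht.1)
  have hSne : S.Nonempty := by
    refine ⟨t₁, ?_⟩
    rw [not_and_or, not_lt, not_lt] at hcon
    exact hcon.imp (fun h => ⟨ht₁, h⟩) (fun h => ⟨ht₁, h⟩)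
  obtain ⟨m, hmS, hmin⟩ := hSc.exists_isLeast hSne
  have hm : m ∈ Icc s T := by rcases hmS with h | h <;> exact h.1
  have hbefore : ∀ r ∈ Ico s m,
      |p r| < α * Real.exp (k * (r - s)) ∧ |w r| < β * Real.exp (k * (r - s)) := by
    intro r hr
    have hrT : r ∈ Icc s T := ⟨hr.1, hr.2.le.trans hm.2⟩
    constructor
    · by_contra h
      exact absurd (hmin (Or.inl ⟨hrT, not_lt.mp h⟩)) (not_le.mpr hr.2)
    · by_contra h
      exact absurd (hmin (Or.inr ⟨hrT, not_lt.mp h⟩)) (not_le.mpr hr.2)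
  have hsub : uIcc s m ⊆ uIcc s T := by
    rw [uIcc_of_le hm.1, uIcc_of_le hsT]; exact Icc_subset_Icc_right hm.2
  -- The bounds are known only before the exit time m, so the null set {m} is discarded.
  have hne : ∀ᵐ t : ℝ, t ≠ m := Measure.ae_ne volume m
  have hd' : ∀ᵐ t, t ∈ Ioc s m →
      |deriv p t + c * p t| ≤ (k + c) * (α * Real.exp (k * (t - s))) ∧
      |deriv w t + c * w t| ≤ (k + c) * (β * Real.exp (k * (t - s))) := by
    filter_upwards [hd, hne] with t h1 h2 ht
    have htm : t < m := lt_of_le_of_ne ht.2 h2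
    exact h1 ⟨ht.1, htm.trans_le hm.2⟩ fun r hr => hbefore r ⟨hr.1, hr.2.trans_lt htm⟩
  have hpm := abs_lt_mul_exp_of_abs_deriv_add_le hm.1 (hp.mono hsub) hp0
    (hd'.mono fun t h ht => (h ht).1)
  have hwm := abs_lt_mul_exp_of_abs_deriv_add_le hm.1 (hw.mono hsub) hw0
    (hd'.mono fun t h ht => (h ht).2)
  rcases hmS with h | h
  · exact absurd h.2 (not_le.mpr hpm)
  · exact absurd h.2 (not_le.mpr hwm)

/-- A function with a continuous one-sided derivative is absolutely continuous. -/
lemma absolutelyContinuousOnInterval_of_hasDerivWithinAt {x y : ℝ → ℝ} {s T : ℝ} (hsT : s ≤ T)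
    (hx : ∀ t, s ≤ t → HasDerivWithinAt x (y t) (Ici s) t)
    (hy : AbsolutelyContinuousOnInterval y s T) : AbsolutelyContinuousOnInterval x s T := by
  obtain ⟨C, hC⟩ := hy.exists_bound
  refine LipschitzOnWith.absolutelyContinuousOnInterval (K := C.toNNReal) ?_
  refine Convex.lipschitzOnWith_of_nnnorm_hasDerivWithin_le (f' := y) (convex_uIcc _ _) ?_ ?_
  · intro t ht
    rw [uIcc_of_le hsT] at ht ⊢
    exact (hx t ht.1).mono Icc_subset_Ici_self
  · intro t ht
    exact NNReal.le_toNNReal_of_coe_le (hC t ht)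

/-! ### A priori exponential growth -/

namespace DampedDelayEquation

lemma EssBddFrom.exists_ae_abs_le {t₀ : ℝ} {f : ℝ → ℝ} (hf : EssBddFrom t₀ f) :
    ∃ C : ℝ, 0 ≤ C ∧ ∀ᵐ t, t₀ ≤ t → |f t| ≤ C := by
  refine ⟨lpNorm f ⊤ (volume.restrict (Ici t₀)), lpNorm_nonneg, ?_⟩
  have := ae_le_lpNorm_exponent_top hf
  rwa [ae_restrict_iff' measurableSet_Ici] at this

lemma IsSolution.hasDerivAt {E : DampedDelayEquation} {s : ℝ} {φ ψ : ℝ → ℝ} {x₀ x₀' : ℝ}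
    {x y : ℝ → ℝ} (hsol : E.IsSolution s φ ψ x₀ x₀' x y) {t : ℝ} (ht : s < t) :
    HasDerivAt x (y t) t :=
  (hsol.hasDeriv t ht.le).hasDerivAt (Ici_mem_nhds ht)

/-- Solutions and their derivatives grow at most exponentially, at a rate that depends on the
coefficients only. -/
lemma IsAdmissible.exists_growth_bound {E : DampedDelayEquation} (hE : E.IsAdmissible) :
    ∃ L : ℝ, 0 < L ∧ ∀ (s : ℝ) (φ ψ : ℝ → ℝ) (x₀ x₀' : ℝ) (x y : ℝ → ℝ) (R : ℝ), 0 ≤ s →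
      E.IsSolution s φ ψ x₀ x₀' x y →
      (∀ r < s, |x r| ≤ R ∧ |y r| ≤ R) → |x s| < R → |y s| < R →
      ∀ t, s ≤ t → |x t| < R * Real.exp (L * (t - s)) ∧ |y t| < R * Real.exp (L * (t - s)) := by
  obtain ⟨A, hA0, hA⟩ := hE.essBdd_a.exists_ae_abs_le
  obtain ⟨B, hB0, hB⟩ := hE.essBdd_b.exists_ae_abs_le
  obtain ⟨A₁, hA₁0, hA₁⟩ := hE.essBdd_a₁.exists_ae_abs_le
  obtain ⟨B₁, hB₁0, hB₁⟩ := hE.essBdd_b₁.exists_ae_abs_le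
  -- The summand 1 pays for the row x' = y; the others bound y'.
  refine ⟨1 + A + B + A₁ + B₁, by positivity, ?_⟩
  intro s φ ψ x₀ x₀' x y R hs hsol hpast hxs hys t ht
  set L := 1 + A + B + A₁ + B₁ with hL
  have hL1 : 1 ≤ L := by linarith
  have hR : 0 < R := (abs_nonneg _).trans_lt hxs
  have hy := hsol.absCont t ht
  have hx := absolutelyContinuousOnInterval_of_hasDerivWithinAt ht hsol.hasDeriv hy
  have heq := hsol.equation
  rw [ae_restrict_iff' measurableSet_Ici] at heq
  refine abs_lt_mul_exp_of_abs_deriv_add_le_of_forall (c := 0) hx hy hxs hys ?_ t ⟨ht, le_rfl⟩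
  filter_upwards [hA, hB, hA₁, hB₁, heq] with u hAu hBu hA₁u hB₁u hequ hu hbd
  have hu0 : 0 ≤ u := hs.trans hu.1.le
  set U := R * Real.exp (L * (u - s)) with hU
  have hU0 : 0 < U := by positivity
  have hle : ∀ r ≤ u, |x r| ≤ U ∧ |y r| ≤ U := by
    intro r hr
    rcases lt_or_ge r s with hrs | hrs
    · have : R ≤ U := le_mul_of_one_le_right hR.le
        (Real.one_le_exp (mul_nonneg (by linarith) (by linarith [hu.1])))
      exact ⟨(hpast r hrs).1.trans this, (hpast r hrs).2.trans this⟩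
    · have : R * Real.exp (L * (r - s)) ≤ U := by rw [hU]; gcongr
      exact ⟨((hbd r ⟨hrs, hr⟩).1.le).trans this, ((hbd r ⟨hrs, hr⟩).2.le).trans this⟩
  have hprod : ∀ {C k v : ℝ}, |k| ≤ C → |v| ≤ U → |k * v| ≤ C * U := by
    intro C k v hk hv
    rw [abs_mul]
    exact mul_le_mul hk hv (abs_nonneg _) ((abs_nonneg _).trans hk)
  have e := hequ hu.1.le
  have e1 := abs_le.mp (hprod (hAu hu0) (hle u le_rfl).2)
  have e2 := abs_le.mp (hprod (hBu hu0) (hle u le_rfl).1)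
  have e3 := abs_le.mp (hprod (hA₁u hu0) (hle _ (hE.delayed_g.le_self u hu0)).2)
  have e4 := abs_le.mp (hprod (hB₁u hu0) (hle _ (hE.delayed_h.le_self u hu0)).1)
  have hLU : L * U = U + A * U + B * U + A₁ * U + B₁ * U := by rw [hL]; ring
  simp only [(hsol.hasDerivAt hu.1).deriv, zero_mul, add_zero]
  constructor
  · refine (hle u le_rfl).2.trans ?_
    nlinarith
  · rw [abs_le, hLU]
    constructor <;> linarith [e1.1, e1.2, e2.1, e2.2, e3.1, e3.2, e4.1, e4.2]

/-! ### Decay by comparison with a positive vector -/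

/-- A decay rate that the damping and the delay leave room for. -/
lemma exists_decay_rate {l A b₀ q τ : ℝ} (hl : 0 < l) (hb₀ : 0 < b₀) (hq : q < 1) :
    ∃ m : ℝ, 0 < m ∧ m < l ∧ m * A ≤ b₀ * (1 - q * Real.exp (m * τ)) := by
  have hcont : Continuous fun m : ℝ => b₀ * (1 - q * Real.exp (m * τ)) - m * A := by fun_prop
  have h0 : 0 < b₀ * (1 - q * Real.exp (0 * τ)) - 0 * A := by
    simpa using mul_pos hb₀ (by linarith : 0 < 1 - q)
  have hev := (hcont.tendsto 0).eventually (lt_mem_nhds h0)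
  have hev' : ∀ᶠ m in nhdsWithin (0 : ℝ) (Ioi 0),
      0 < b₀ * (1 - q * Real.exp (m * τ)) - m * A := hev.filter_mono nhdsWithin_le_nhds
  obtain ⟨m, hm, hmI⟩ := (hev'.and (Ioo_mem_nhdsGT hl)).exists
  exact ⟨m, hmI.1, hmI.2, by linarith⟩

/-- Decay of solutions from a time `σ` on after which the conditions on the coefficients hold:
in the variables `x` and `y + l x` the equation is a cooperative system, with `(1, l - m)` as a
positive vector that is contracted at rate `m`. -/
lemma IsSolution.abs_lt_mul_exp {E : DampedDelayEquation} {s : ℝ} {φ ψ : ℝ → ℝ} {x₀ x₀' : ℝ}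
    {x y : ℝ → ℝ} (hsol : E.IsSolution s φ ψ x₀ x₀' x y) {σ l m A b₀ q τ K : ℝ}
    (hsσ : s ≤ σ) (hm : 0 < m) (hml : m < l) (hA : 2 * l ≤ A) (hb₀ : 0 < b₀) (hq : 0 ≤ q)
    (hrate : m * A ≤ b₀ * (1 - q * Real.exp (m * τ)))
    (ha : ∀ᵐ t, σ ≤ t → 2 * l ≤ E.a t ∧ E.a t ≤ A)
    (hb : ∀ᵐ t, σ ≤ t → b₀ ≤ E.b t ∧ E.b t ≤ l ^ 2)
    (ha₁ : ∀ᵐ t, σ ≤ t → E.a₁ t = 0)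
    (hb₁ : ∀ᵐ t, σ ≤ t → |E.b₁ t| ≤ q * E.b t)
    (hh : ∀ t, σ ≤ t → E.h t ≤ t) (hτ : ∀ t, σ ≤ t → t - E.h t ≤ τ)
    (hpast : ∀ r < σ, |x r| ≤ K) (hxσ : |x σ| < K) (hzσ : |y σ + l * x σ| < (l - m) * K)
    {t : ℝ} (ht : σ ≤ t) : |x t| < K * Real.exp (-m * (t - σ)) := by
  have hK : 0 < K := (abs_nonneg _).trans_lt hxσ
  have hst : s ≤ t := hsσ.trans ht
  have hy := hsol.absCont t hst
  have hx := absolutelyContinuousOnInterval_of_hasDerivWithinAt hst hsol.hasDeriv hy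
  have hsub : uIcc σ t ⊆ uIcc s t := by
    rw [uIcc_of_le ht, uIcc_of_le hst]; exact Icc_subset_Icc_left hsσ
  replace hy := hy.mono hsub
  replace hx := hx.mono hsub
  have hz : AbsolutelyContinuousOnInterval (fun t => y t + l * x t) σ t :=
    hy.fun_add (hx.const_mul l)
  have heq := hsol.equation
  rw [ae_restrict_iff' measurableSet_Ici] at heq
  -- The shift c = A - l makes both diagonal entries, A - 2l and A - a, nonnegative, so absolute
  -- values can be taken term by term.
  refine (abs_lt_mul_exp_of_abs_deriv_add_le_of_forall (p := x) (w := fun t => y t + l * x t)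
    (c := A - l) (k := -m) hx hz hxσ hzσ ?_ t ⟨ht, le_rfl⟩).1
  filter_upwards [ha, hb, ha₁, hb₁, heq, hy.ae_differentiableAt] with u hau hbu ha₁u hb₁u hequ
    hydu hu hbd
  have hσu : σ ≤ u := hu.1.le
  have hdx := hsol.hasDerivAt (hsσ.trans_lt hu.1)
  have hdy : HasDerivAt y (deriv y u) u :=
    (hydu (by rw [uIcc_of_le ht]; exact Ioo_subset_Icc_self hu)).hasDerivAt
  have hdz : deriv (fun t => y t + l * x t) u = deriv y u + l * y u :=
    (hdy.add (hdx.const_mul l)).deriv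
  rw [hdx.deriv, hdz]
  obtain ⟨ha1, ha2⟩ := hau hσu
  obtain ⟨hb1, hb2⟩ := hbu hσu
  have e := hequ (hsσ.trans hσu)
  rw [ha₁u hσu, zero_mul, add_zero] at e
  set Q := Real.exp (m * τ) with hQ
  set U := K * Real.exp (-m * (u - σ)) with hU
  have hU0 : 0 < U := by positivity
  have hxu : |x u| ≤ U := (hbd u ⟨hσu, le_rfl⟩).1.le
  have hzu : |y u + l * x u| ≤ (l - m) * U := by
    have := (hbd u ⟨hσu, le_rfl⟩).2.le
    rwa [mul_assoc] at this
  have hxh : |x (E.h u)| ≤ Q * U := by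
    have hexp : K * Real.exp (-m * (E.h u - σ)) ≤ Q * U := by
      have : Q * U = K * Real.exp (m * τ + -m * (u - σ)) := by
        rw [Real.exp_add, hQ, hU]; ring
      rw [this]
      have := mul_le_mul_of_nonneg_left (hτ u hσu) hm.le
      gcongr
      linarith
    rcases lt_or_ge (E.h u) σ with hlt | hge
    · refine (hpast _ hlt).trans (le_trans ?_ hexp)
      -- To the left of σ the barrier exceeds K, so the bound on the past suffices.
      exact le_mul_of_one_le_right hK.le (Real.one_le_exp (by nlinarith))
    · exact ((hbd _ ⟨hge, hh u hσu⟩).1.le).trans hexp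
  have hf : |E.b₁ u * x (E.h u)| ≤ q * E.b u * (Q * U) := by
    rw [abs_mul]
    exact mul_le_mul (hb₁u hσu) hxh (abs_nonneg _) (mul_nonneg hq (hb₀.le.trans hb1))
  have hAl : |(A - 2 * l) * x u| ≤ (A - 2 * l) * U := by
    rw [abs_mul, abs_of_nonneg (by linarith : 0 ≤ A - 2 * l)]
    exact mul_le_mul_of_nonneg_left hxu (by linarith)
  have hAa : |(A - E.a u) * (y u + l * x u)| ≤ (A - E.a u) * ((l - m) * U) := by
    rw [abs_mul, abs_of_nonneg (by linarith : 0 ≤ A - E.a u)]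
    exact mul_le_mul_of_nonneg_left hzu (by linarith)
  have hcoef : 0 ≤ l * (E.a u - l) - E.b u := by nlinarith
  have hlb : |(l * (E.a u - l) - E.b u) * x u| ≤ (l * (E.a u - l) - E.b u) * U := by
    rw [abs_mul, abs_of_nonneg hcoef]
    exact mul_le_mul_of_nonneg_left hxu hcoef
  constructor
  · have hid : y u + (A - l) * x u = (y u + l * x u) + (A - 2 * l) * x u := by ring
    rw [hid]
    refine (abs_add_le _ _).trans ((add_le_add hzu hAl).trans (le_of_eq ?_))
    ring
  · have hid : deriv y u + l * y u + (A - l) * (y u + l * x u) =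
        (A - E.a u) * (y u + l * x u) + (l * (E.a u - l) - E.b u) * x u
          - E.b₁ u * x (E.h u) := by
      linear_combination e
    rw [hid]
    refine (abs_sub _ _).trans
      ((add_le_add ((abs_add_le _ _).trans (add_le_add hAa hlb)) hf).trans ?_)
    have hqQ : 0 ≤ 1 - q * Q := by
      have : 0 ≤ b₀ * (1 - q * Q) := le_trans (mul_nonneg hm.le (by linarith)) hrate
      exact nonneg_of_mul_nonneg_right this hb₀
    -- This is the second row of the contraction condition after cancellation.
    have key : m * E.a u - m ^ 2 ≤ E.b u * (1 - q * Q) := by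
      have h1 : m * E.a u ≤ m * A := mul_le_mul_of_nonneg_left ha2 hm.le
      have h2 : b₀ * (1 - q * Q) ≤ E.b u * (1 - q * Q) := mul_le_mul_of_nonneg_right hb1 hqQ
      nlinarith [sq_nonneg m]
    have := mul_le_mul_of_nonneg_right key hU0.le
    rw [mul_assoc (l - m) K, ← hU]
    linarith

/-- Under the damping condition, after `t₀` the coefficients lie almost everywhere within bounds
that suffice for decay. -/
lemma DampingCondition.exists_ae_bounds {E : DampedDelayEquation} (hE : E.IsAdmissible) {t₀ : ℝ}
    (ht₀ : 0 ≤ t₀) (hdamp : E.DampingCondition t₀) :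
    ∃ l A b₀ : ℝ, 0 < l ∧ 0 < b₀ ∧ 2 * l ≤ A ∧
      (∀ᵐ t, t₀ ≤ t → 2 * l ≤ E.a t ∧ E.a t ≤ A) ∧
      (∀ᵐ t, t₀ ≤ t → b₀ ≤ E.b t ∧ E.b t ≤ l ^ 2) := by
  obtain ⟨A, -, hA⟩ := hE.essBdd_a.exists_ae_abs_le
  obtain ⟨B, -, hB⟩ := hE.essBdd_b.exists_ae_abs_le
  have hrestr : ∀ {f : ℝ → ℝ} {C : ℝ}, (∀ᵐ t, 0 ≤ t → |f t| ≤ C) →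
      ∀ᵐ t ∂(volume.restrict (Ici t₀)), |f t| ≤ C := by
    intro f C hf
    rw [ae_restrict_iff' measurableSet_Ici]
    exact hf.mono fun t h ht => h (ht₀.trans ht)
  -- Essential bounds of real functions are meaningful only for functions bounded on the relevant
  -- side, hence the witnesses.
  have ha := ae_essInf_le (μ := volume.restrict (Ici t₀)) (f := E.a)
    ⟨-A, eventually_map.mpr ((hrestr hA).mono fun t h => (abs_le.mp h).1)⟩
  have hb := ae_essInf_le (μ := volume.restrict (Ici t₀)) (f := E.b)
    ⟨-B, eventually_map.mpr ((hrestr hB).mono fun t h => (abs_le.mp h).1)⟩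
  have hb' := ae_le_essSup (μ := volume.restrict (Ici t₀)) (f := E.b)
    ⟨B, eventually_map.mpr ((hrestr hB).mono fun t h => (abs_le.mp h).2)⟩
  rw [ae_restrict_iff' measurableSet_Ici] at ha hb hb'
  set a₀ := essInf E.a (volume.restrict (Ici t₀)) with ha₀
  -- With l = a₀/2, the bound b ≤ l² is exactly a₀² ≥ 4 sup b.
  refine ⟨a₀ / 2, max A a₀, essInf E.b (volume.restrict (Ici t₀)), half_pos hdamp.inf_a_pos,
    hdamp.inf_b_pos, by rw [mul_div_cancel₀ _ two_ne_zero]; exact le_max_right _ _, ?_, ?_⟩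
  · filter_upwards [ha, hA] with t h1 h2 ht
    exact ⟨by linarith [h1 ht], (le_abs_self _).trans ((h2 (ht₀.trans ht)).trans (le_max_left _ _))⟩
  · filter_upwards [hb, hb'] with t h1 h2 ht
    refine ⟨h1 ht, (h2 ht).trans ?_⟩
    have := hdamp.four_mul_sup_b_le
    rw [div_pow]
    linarith

end DampedDelayEquation

lemma ae_abs_le_mul_of_eLpNorm_div_lt_one {f g : ℝ → ℝ} {t₀ : ℝ}
    (hg : ∀ᵐ t, t₀ ≤ t → 0 < g t)
    (hnorm : eLpNorm (fun t => f t / g t) ⊤ (volume.restrict (Ici t₀)) < 1) :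
    ∃ q : ℝ, 0 ≤ q ∧ q < 1 ∧ ∀ᵐ t, t₀ ≤ t → |f t| ≤ q * g t := by
  set N := eLpNorm (fun t => f t / g t) ⊤ (volume.restrict (Ici t₀)) with hN
  have hNtop : N ≠ ⊤ := (hnorm.trans ENNReal.one_lt_top).ne
  refine ⟨N.toReal, ENNReal.toReal_nonneg, ?_, ?_⟩
  · simpa using (ENNReal.toReal_lt_toReal hNtop ENNReal.one_ne_top).mpr hnorm
  · have h : ∀ᵐ t ∂(volume.restrict (Ici t₀)), ‖f t / g t‖ₑ ≤ N := by
      rw [hN, eLpNorm_exponent_top]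
      exact ae_le_eLpNormEssSup
    rw [ae_restrict_iff' measurableSet_Ici] at h
    filter_upwards [h, hg] with t h1 h2 ht
    have h3 := ENNReal.toReal_mono hNtop (h1 ht)
    rw [toReal_enorm, Real.norm_eq_abs, abs_div, abs_of_pos (h2 ht)] at h3
    exact (div_le_iff₀ (h2 ht)).mp h3

/-! ### Gluing growth and decay -/

theorem corollary7 (E : DampedDelayEquation) (hE : E.IsAdmissible)
    (t₀ τ : ℝ) (ht₀ : 0 ≤ t₀)
    (hdamp : E.DampingCondition t₀)
    (ha₁ : ∀ᵐ t ∂(volume.restrict (Ici t₀)), E.a₁ t = 0)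
    (hτ : ∀ t, t₀ ≤ t → t - E.h t ≤ τ)
    (hnorm : eLpNorm (fun t => E.b₁ t / E.b t) ⊤ (volume.restrict (Ici t₀)) < 1) :
    E.ExponentiallyStable := by
  obtain ⟨L, hL, hgrowth⟩ := hE.exists_growth_bound
  obtain ⟨l, A, b₀, hl, hb₀, hlA, ha, hb⟩ := hdamp.exists_ae_bounds hE ht₀
  obtain ⟨q, hq0, hq1, hb₁⟩ := ae_abs_le_mul_of_eLpNorm_div_lt_one
    (hb.mono fun t h ht => hb₀.trans_le (h ht).1) hnorm
  rw [ae_restrict_iff' measurableSet_Ici] at ha₁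
  obtain ⟨m, hm, hml, hrate⟩ := DampedDelayEquation.exists_decay_rate (A := A) (τ := τ) hl hb₀ hq1
  have hlm : 0 < l - m := by linarith
  set C := 1 + (1 + l) / (l - m) with hC
  have hC1 : 1 ≤ C := by rw [hC]; linarith [div_nonneg (by linarith : 0 ≤ 1 + l) hlm.le]
  -- C is chosen so that |x|, |y| < R at σ gives |y + l x| < (l - m) C R.
  have hClm : 1 + l ≤ (l - m) * C := by
    rw [hC, mul_add, mul_div_cancel₀ _ hlm.ne']; linarith
  refine ⟨C * Real.exp (L * t₀) * Real.exp (m * t₀), by positivity, m, hm, ?_⟩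
  intro s φ ψ x₀ x₀' x y hs hφ hψ hsol t ht
  set D := |x₀| + |x₀'| + ⨆ r : Iio s, (|φ r| + |ψ r|) with hD
  obtain ⟨Cφ, hCφ⟩ := hφ.bounded
  obtain ⟨Cψ, hCψ⟩ := hψ.bounded
  have hbdd : BddAbove (range fun r : Iio s => |φ r| + |ψ r|) := by
    refine ⟨Cφ + Cψ, ?_⟩
    rintro _ ⟨r, rfl⟩
    exact add_le_add (hCφ r r.2) (hCψ r r.2)
  have hsup0 : 0 ≤ ⨆ r : Iio s, (|φ r| + |ψ r|) := Real.iSup_nonneg fun r => by positivity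
  have hpast : ∀ r < s, |x r| ≤ D ∧ |y r| ≤ D := by
    intro r hr
    have h := le_ciSup hbdd ⟨r, hr⟩
    simp only at h
    rw [hsol.eq_before r hr, hsol.deriv_eq_before r hr]
    constructor <;> linarith [abs_nonneg (φ r), abs_nonneg (ψ r), abs_nonneg x₀, abs_nonneg x₀']
  have hD0 : 0 ≤ D := by positivity
  -- The barriers need strict initial inequalities, and D may be 0; δ tends to 0 at the end.
  have hmain : ∀ δ > 0, |x t| ≤
      C * Real.exp (L * t₀) * Real.exp (m * t₀) * Real.exp (-m * (t - s)) * (D + δ) := by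
    intro δ hδ
    set σ := max s t₀ with hσ
    have hsσ : s ≤ σ := le_max_left _ _
    have htσ : t₀ ≤ σ := le_max_right _ _
    have hσs : σ - s ≤ t₀ := by
      rcases max_cases s t₀ with h | h <;> rw [hσ] <;> linarith [h.1]
    have hg := hgrowth s φ ψ x₀ x₀' x y (D + δ) hs hsol
      (fun r hr => ⟨(hpast r hr).1.trans (by linarith), (hpast r hr).2.trans (by linarith)⟩)
      (by rw [hsol.eq_at]; linarith [abs_nonneg x₀'])
      (by rw [hsol.deriv_eq_at]; linarith [abs_nonneg x₀])
    set R := (D + δ) * Real.exp (L * t₀) with hR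
    have hR0 : 0 < R := by positivity
    have hgR : ∀ r, s ≤ r → r ≤ σ → |x r| < R ∧ |y r| < R := by
      intro r h1 h2
      have : (D + δ) * Real.exp (L * (r - s)) ≤ R := by
        rw [hR]
        gcongr
        linarith
      exact ⟨(hg r h1).1.trans_le this, (hg r h1).2.trans_le this⟩
    have hRCR : R ≤ C * R := le_mul_of_one_le_left hR0.le hC1
    -- Measuring decay from s instead of σ costs at most e^{m t₀}.
    have hexp : ∀ r, Real.exp (-m * (r - σ)) ≤ Real.exp (m * t₀) * Real.exp (-m * (r - s)) := by
      intro r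
      rw [← Real.exp_add]
      gcongr
      nlinarith
    have hfinal : |x t| ≤ C * R * (Real.exp (m * t₀) * Real.exp (-m * (t - s))) := by
      rcases le_total t σ with h | h
      · refine (hgR t ht h).1.le.trans (hRCR.trans (le_mul_of_one_le_right (by positivity) ?_))
        exact (Real.one_le_exp (by nlinarith)).trans (hexp t)
      · have hmono : ∀ {P : ℝ → Prop}, (∀ᵐ r, t₀ ≤ r → P r) → ∀ᵐ r, σ ≤ r → P r :=
          fun hP => hP.mono fun r h1 h2 => h1 (htσ.trans h2)
        have hσR := hgR σ hsσ le_rfl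
        refine (hsol.abs_lt_mul_exp hsσ hm hml hlA hb₀ hq0 hrate (hmono ha) (hmono hb)
          (hmono ha₁) (hmono hb₁)
          (fun r hr => hE.delayed_h.le_self r (ht₀.trans (htσ.trans hr)))
          (fun r hr => hτ r (htσ.trans hr)) ?_ (hσR.1.trans_le hRCR) ?_ h).le.trans
          (mul_le_mul_of_nonneg_left (hexp t) (by positivity))
        · intro r hr
          rcases lt_or_ge r s with h1 | h1
          · refine (hpast r h1).1.trans (le_trans ?_ hRCR)
            rw [hR]
            have := Real.one_le_exp (mul_nonneg hL.le ht₀)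
            nlinarith
          · exact (hgR r h1 hr.le).1.le.trans hRCR
        · calc |y σ + l * x σ| ≤ |y σ| + l * |x σ| := by
                refine (abs_add_le _ _).trans_eq ?_
                rw [abs_mul, abs_of_pos hl]
            _ < R + l * R := add_lt_add_of_lt_of_le hσR.2 (by gcongr; exact hσR.1.le)
            _ = (1 + l) * R := by ring
            _ ≤ ((l - m) * C) * R := by gcongr
            _ = (l - m) * (C * R) := by ring
    refine hfinal.trans_eq ?_
    rw [hR]
    ring
  refine ge_of_tendsto (x := nhdsWithin (0 : ℝ) (Ioi 0)) (f := fun δ =>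
    C * Real.exp (L * t₀) * Real.exp (m * t₀) * Real.exp (-m * (t - s)) * (D + δ)) ?_
    (eventually_mem_nhdsWithin.mono fun δ hδ => hmain δ hδ)
  refine Tendsto.mono_left ?_ nhdsWithin_le_nhds
  exact Continuous.tendsto' (by fun_prop) _ _ (by simp)
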